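/- **Definitions.** Let $1\le m\le d$ and let $v=(v_1,\dots,v_m)$ be pairwise orthogonal unit vectors in $\mathbb R^d$ (Euclidean norm). For an integer $k\ge 2$ and $\Delta>0$, an *arithmetic patch* of size $k$, scale $\Delta$ and orientation $v$ is a set $P=\{t+\Delta\sum_{i=1}^m x_iv_i : x_i\in\{0,1,\dots,k-1\}\}$ with $t\in\mathbb R^d$. For $0<\epsilon<1/2$, a set $Q\subseteq\mathbb R^d$ is a *$(k,\epsilon,v)$-AP* if there is an arithmetic patch $P$ of size $k$, some scale $\Delta>0$ and orientation $v$ with $\sup_{x\in P}\inf_{y\in Q}\|x-y\|\le\epsilon\Delta$. A set contains a $(k,\epsilon,v)$-AP if some subset of it is one. Let $e_i$ denote the $i$-th standard unit vector, and let $r_{k,m}(N)$ be the largest cardinality of a set $A\subseteq\{1,\dots,N\}^m$ that contains no arithmetic patch of size $k$ (of any scale) with orientation $(e_1,\dots,e_m)$. For $E\subseteq\mathbb R^d$ let $N(E,r)$ be the smallest cardinality of a family of sets of diameter at most $r$ covering $E$. The Assouad dimension $\dim_{\mathrm A}F$ is the infimum of the $\sigma\ge0$ for which there is $C>0$ with $N(B(x,R)\cap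 F,r)\le C(R/r)^\sigma$ for all $0<r<R$ and $x\in F$, where $B(x,R)$ is the closed ball. Put $$D_{\mathrm A}(k,\epsilon,d,m)=\sup\{\dim_{\mathrm A}F : F\subseteq\mathbb R^d \text{ contains no }(k,\epsilon,v)\text{-AP for some orthonormal } v=(v_1,\dots,v_m)\}.$$ An iterated function system (IFS) is a finite family $f_1,\dots,f_n$ of contractions of $\mathbb R^d$ (Lipschitz with constant less than $1$); its attractor is the nonempty compact set $F$ with $F=\bigcup_i f_i(F)$. It satisfies the *open set condition* if there is a nonempty bounded open set $V$ such that $f_1(V),\dots,f_n(V)$ are pairwise disjoint subsets of $V$. Put $$D_{\mathrm S}(k,\epsilon,d,m)=\sup\{\dim_{\mathrm H}F : F\subset\mathbb R^d\text{ is the attractor of an IFS with the open set condition and contains no }(k,\epsilon,(e_1,\dots,e_m))\text{-AP}\},$$ where $\dim_{\mathrm H}$ is the Hausdorff dimension, and let $D_{\mathrm S}^{\mathrm{sim}}(k,\epsilon,d,m)$ be the same supremum over those IFSs only whose maps are contracting similarities ($\|f_i(x)-f_i(y)\|=c_i\|x-y\|$ with $0<c_i<1$). **Corollary 2.3.** Let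 $1\le m\le d$ and $k\ge2$ be integers, with $k\ge 3$ if $d=1$, and let $0<\epsilon<1/8$. Then $$d\left(1-\frac{\log 32}{\log(4/\epsilon)}\right)+\frac{\log\bigl(r_{k,m}(\lceil 1/(8\epsilon)\rceil)/\lceil 1/(8\epsilon)\rceil^m\bigr)}{\log(4/\epsilon)}\le D_{\mathrm S}^{\mathrm{sim}}(k,\epsilon,d,m)\le D_{\mathrm S}(k,\epsilon,d,m)\le D_{\mathrm A}(k,\epsilon,d,m)$$ and $$D_{\mathrm A}(k,\epsilon,d,m)\le d+\frac12\,\frac{\log\bigl(r_{k,m}(\lceil\sqrt d/\epsilon\rceil)/\lceil\sqrt d/\epsilon\rceil^m\bigr)}{\log\lceil\sqrt d/\epsilon\rceil}.$$ -/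

import Mathlib

open scoped ENNReal NNReal

noncomputable section

namespace APDim

/-- The points `ℝ^d` with the Euclidean norm. -/
abbrev Space (d : ℕ) : Type := EuclideanSpace ℝ (Fin d)

/-- `P` is an arithmetic patch of size `k` and scale `Δ > 0` with respect to the orientation
`v = (v_1, …, v_m)`: for some `t`,
`P = {t + Δ ∑ i, x_i v_i : x_i = 0, 1, …, k - 1}`. -/
def IsPatch {d m : ℕ} (k : ℕ) (v : Fin m → Space d) (Δ : ℝ) (P : Set (Space d)) : Prop :=
  0 < Δ ∧ ∃ t : Space d,
    P = Set.range fun x : Fin m → Fin k => t + Δ • ∑ i, ((x i : ℕ) : ℝ) • v i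

/-- `Q` is a `(k, ε, v)`-AP: there is a patch `P` of size `k` and some scale `Δ > 0` with
`sup_{x ∈ P} inf_{y ∈ Q} ‖x - y‖ ≤ ε Δ`. The infimum is taken in `[0, ∞]`, so the empty set is
not a `(k, ε, v)`-AP when `P` is nonempty. -/
def IsApproxAP {d m : ℕ} (k : ℕ) (ε : ℝ) (v : Fin m → Space d) (Q : Set (Space d)) : Prop :=
  ∃ (P : Set (Space d)) (Δ : ℝ), IsPatch k v Δ P ∧
    ⨆ x ∈ P, Metric.infEDist x Q ≤ ENNReal.ofReal (ε * Δ)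

/-- `F` contains a `(k, ε, v)`-AP. -/
def ContainsApproxAP {d m : ℕ} (k : ℕ) (ε : ℝ) (v : Fin m → Space d) (F : Set (Space d)) : Prop :=
  ∃ Q ⊆ F, IsApproxAP k ε v Q

/-- The first `m` standard unit vectors `e_1, …, e_m` of `ℝ^d`. -/
def stdVec {d m : ℕ} (h : m ≤ d) (i : Fin m) : Space d :=
  EuclideanSpace.single (Fin.castLE h i) 1

/-- The inclusion of `ℕ^m` into `ℝ^m`. -/
def latticePoint {m : ℕ} (a : Fin m → ℕ) : Space m :=
  WithLp.toLp 2 fun i => (a i : ℝ)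

/-- `A ⊆ ℕ^m` contains no arithmetic patch of size `k` with orientation `e_1, …, e_m`. -/
def PatchFree {m : ℕ} (k : ℕ) (A : Finset (Fin m → ℕ)) : Prop :=
  ∀ (P : Set (Space m)) (Δ : ℝ), IsPatch k (stdVec (le_refl m)) Δ P →
    ¬ P ⊆ latticePoint '' (A : Set (Fin m → ℕ))

open Classical in
/-- `r_{k,m}(N)`: the largest cardinality of a subset of `{1, …, N}^m` that contains no
arithmetic patch of size `k` with orientation `e_1, …, e_m`. -/
def rkm (k m N : ℕ) : ℕ :=
  ((Finset.Icc (fun _ : Fin m => 1) (fun _ : Fin m => N)).powerset.filter (PatchFree k)).sup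
    Finset.card

/-- `N(E, r)`: the smallest cardinality of a family of sets of diameter at most `r` that
covers `E` (`∞` if there is no finite one). -/
def coverNumber {X : Type*} [PseudoEMetricSpace X] (E : Set X) (r : ℝ) : ℕ∞ :=
  ⨅ (𝒰 : Set (Set X)) (_ : E ⊆ ⋃₀ 𝒰 ∧ ∀ U ∈ 𝒰, Metric.ediam U ≤ ENNReal.ofReal r), 𝒰.encard

/-- The Assouad dimension: the infimum of the `σ ≥ 0` for which there is a `C > 0` with
`N(B(x, R) ∩ F, r) ≤ C (R / r) ^ σ` for all `0 < r < R` and all `x ∈ F`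
(`B(x, R)` is the closed ball). -/
def assouadDim {X : Type*} [PseudoMetricSpace X] (F : Set X) : ℝ≥0∞ :=
  ⨅ (σ : ℝ≥0) (_ : ∃ C : ℝ, 0 < C ∧ ∀ r : ℝ, 0 < r → ∀ R : ℝ, r < R → ∀ x ∈ F,
    ((coverNumber (Metric.closedBall x R ∩ F) r : ℕ∞) : ℝ≥0∞)
      ≤ ENNReal.ofReal (C * (R / r) ^ (σ : ℝ))), (σ : ℝ≥0∞)

/-- The open set condition for a finite family `f_1, …, f_n` of self-maps: some nonempty bounded
open `V` contains the pairwise disjoint sets `f_1(V), …, f_n(V)`. -/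
def OpenSetCondition {d n : ℕ} (f : Fin n → Space d → Space d) : Prop :=
  ∃ V : Set (Space d), IsOpen V ∧ V.Nonempty ∧ Bornology.IsBounded V ∧
    (∀ i, f i '' V ⊆ V) ∧ Pairwise fun i j => Disjoint (f i '' V) (f j '' V)

/-- `F` is the attractor (the nonempty compact invariant set) of an iterated function system,
that is, a finite family of contractions, that satisfies the open set condition. -/
def IsAttractorOSC {d : ℕ} (F : Set (Space d)) : Prop :=
  IsCompact F ∧ F.Nonempty ∧ ∃ (n : ℕ) (f : Fin n → Space d → Space d),
    (∀ i, ∃ K : ℝ≥0, ContractingWith K (f i)) ∧ OpenSetCondition f ∧ F = ⋃ i, f i '' F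

/-- `F` is the attractor of an iterated function system of contracting similarities that
satisfies the open set condition. -/
def IsSelfSimilarOSC {d : ℕ} (F : Set (Space d)) : Prop :=
  IsCompact F ∧ F.Nonempty ∧ ∃ (n : ℕ) (f : Fin n → Space d → Space d),
    (∀ i, ∃ c : ℝ, 0 < c ∧ c < 1 ∧ ∀ x y, dist (f i x) (f i y) = c * dist x y) ∧
      OpenSetCondition f ∧ F = ⋃ i, f i '' F

/-- `D_A(k, ε, d, m)`: the supremum of the Assouad dimensions of the sets `F ⊆ ℝ^d` that contain
no `(k, ε, v)`-AP for some orthonormal `v = (v_1, …, v_m)`. -/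
def DA (k : ℕ) (ε : ℝ) (d m : ℕ) : ℝ≥0∞ :=
  ⨆ (F : Set (Space d))
    (_ : ∃ v : Fin m → Space d, Orthonormal ℝ v ∧ ¬ ContainsApproxAP k ε v F), assouadDim F

/-- `D_S(k, ε, d, m)`: the supremum of the Hausdorff dimensions of the attractors in `ℝ^d` of
iterated function systems with the open set condition that contain no
`(k, ε, (e_1, …, e_m))`-AP. -/
def DS (k : ℕ) (ε : ℝ) {d m : ℕ} (h : m ≤ d) : ℝ≥0∞ :=
  ⨆ (F : Set (Space d)) (_ : IsAttractorOSC F ∧ ¬ ContainsApproxAP k ε (stdVec h) F), dimH F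

/-- The same supremum as `DS`, over the iterated function systems of similarities only. -/
def DSsim (k : ℕ) (ε : ℝ) {d m : ℕ} (h : m ≤ d) : ℝ≥0∞ :=
  ⨆ (F : Set (Space d)) (_ : IsSelfSimilarOSC F ∧ ¬ ContainsApproxAP k ε (stdVec h) F), dimH F

end APDim

end

/-!
Upper bound. Let `N = ⌈√d / ε⌉` and suppose `F` contains no `(k, ε, v)`-AP. Cut a cube, with sides
along an orthonormal basis extending `v`, into `N ^ 2` parts per side, and sort the cells by the
residues of their indices modulo `N`. Cells in one class sit on a grid whose step is `N` cell sides,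
so the diameter of a cell is at most `ε` times the step, and a patch among the cells met by `F` would
give a `(k, ε, v)`-AP in `F`. Hence each of the `N ^ d` classes contains at most
`N ^ (d - m) * rkm k m N` such cells (`card_cells_le`). Iterating over scales
(`hasCover_of_mem_cube`) bounds the covering numbers, and the cells having relative size `N ^ (-2)`
produces the factor `1 / 2`.

Lower bound. Let `N = ⌈1 / (8 ε)⌉` and let `A ⊆ {1, …, N} ^ m` be a largest patch-free set. The
attractor of the maps `x ↦ 7 ε (a - 1) + (ε / 4) x`, where `a ∈ {1, …, N} ^ d` has its first `m`
coordinates in `A`, satisfies the open set condition with the open unit cube. If it came within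
`ε Δ` of a patch of scale `Δ`, the first level cells of the approximating points would either form a
patch in `A` or coincide (`digit_eq_of_approx_patch`); after rescaling, the same holds at every
level, so all the approximating points would be equal, which is absurd. Reading codes as digits maps
the attractor onto `[0, 1]` by a Hölder map, which bounds its Hausdorff dimension from below
(`le_dimH_range_codePoint`).

The middle inequalities hold because similarities are contractions and the Hausdorff dimension of a
bounded set is at most its Assouad dimension (`dimH_le_assouadDim`).
-/

namespace APDim

/-! ### Patches and patch-free sets -/

/-- The last `d - m` coordinates of `Fin d`, complementary to the range of `Fin.castLE h`. -/
def tailIdx {d m : ℕ} (h : m ≤ d) (j : Fin (d - m)) : Fin d :=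
  ⟨m + j, by have := j.2; omega⟩

theorem eq_castLE_or_eq_tailIdx {d m : ℕ} (h : m ≤ d) (i : Fin d) :
    (∃ j, i = Fin.castLE h j) ∨ ∃ j, i = tailIdx h j := by
  by_cases hi : (i : ℕ) < m
  · exact Or.inl ⟨⟨i, hi⟩, by ext; simp⟩
  · exact Or.inr ⟨⟨i - m, by have := i.2; omega⟩, by ext; simp [tailIdx]; omega⟩

theorem tailIdx_ne_castLE {d m : ℕ} (h : m ≤ d) (j : Fin (d - m)) (i : Fin m) :
    tailIdx h j ≠ Fin.castLE h i := by
  intro e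
  have := congrArg Fin.val e
  have := i.2
  simp [tailIdx] at *
  omega

theorem patchPoint_castLE {d m : ℕ} (h : m ≤ d) (t : Space d) (Δ : ℝ) (x : Fin m → ℝ)
    (j : Fin m) :
    (t + Δ • ∑ i, x i • stdVec h i) (Fin.castLE h j) = t (Fin.castLE h j) + Δ * x j := by
  simp [stdVec, Finset.sum_apply, Pi.single_apply, Fin.castLE_inj]

theorem patchPoint_tailIdx {d m : ℕ} (h : m ≤ d) (t : Space d) (Δ : ℝ) (x : Fin m → ℝ)
    (j : Fin (d - m)) :
    (t + Δ • ∑ i, x i • stdVec h i) (tailIdx h j) = t (tailIdx h j) := by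
  simp [stdVec, Finset.sum_apply, tailIdx_ne_castLE]

theorem orthonormal_stdVec {d m : ℕ} (h : m ≤ d) : Orthonormal ℝ (stdVec h) := by
  have := (EuclideanSpace.basisFun (Fin d) ℝ).orthonormal.comp _ (Fin.castLE_injective h)
  convert! this using 1
  ext i j
  simp [stdVec]

/-- Patches contained in `ℕ^m` have an integer base point and an integer scale, so
patch-freeness is a statement about integers. -/
theorem patchFree_iff {m k : ℕ} (hk : 2 ≤ k) (hm : 1 ≤ m) (A : Finset (Fin m → ℕ)) :
    PatchFree k A ↔
      ∀ (a : Fin m → ℕ) (p : ℕ), 0 < p → ∃ x : Fin m → Fin k, (fun i => a i + p * x i) ∉ A := by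
  constructor
  · intro hA a p hp
    by_contra! hc
    refine hA _ p ⟨by exact_mod_cast hp, latticePoint a, rfl⟩ ?_
    rintro _ ⟨x, rfl⟩
    refine ⟨_, hc x, ?_⟩
    ext j
    have := patchPoint_castLE (le_refl m) (latticePoint a) p (fun i => ((x i : ℕ) : ℝ)) j
    simp only [Fin.castLE_rfl, id] at this
    rw [this]
    simp [latticePoint]
  · rintro hA P Δ ⟨hΔ, t, rfl⟩ hP
    have key : ∀ x : Fin m → Fin k, ∃ b ∈ A, ∀ j, (b j : ℝ) = t j + Δ * (x j : ℕ) := by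
      intro x
      obtain ⟨b, hb, e⟩ := hP ⟨x, rfl⟩
      beta_reduce at e
      refine ⟨b, hb, fun j => ?_⟩
      have := patchPoint_castLE (le_refl m) t Δ (fun i => ((x i : ℕ) : ℝ)) j
      simp only [Fin.castLE_rfl, id] at this
      rw [← this, ← e]
      simp [latticePoint]
    obtain ⟨a, -, ha⟩ := key fun _ => ⟨0, by omega⟩
    obtain ⟨b, -, hb⟩ := key fun _ => ⟨1, by omega⟩
    have hi := hb ⟨0, hm⟩
    simp only [Nat.cast_zero, mul_zero, add_zero, Nat.cast_one, mul_one] at ha hi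
    rw [← ha] at hi
    have hlt : a ⟨0, hm⟩ < b ⟨0, hm⟩ := by
      have : (a ⟨0, hm⟩ : ℝ) < b ⟨0, hm⟩ := by linarith
      exact_mod_cast this
    obtain ⟨x, hx⟩ := hA a (b ⟨0, hm⟩ - a ⟨0, hm⟩) (by omega)
    obtain ⟨c, hc, e⟩ := key x
    refine hx ?_
    convert hc using 1
    ext j
    have : (c j : ℝ) = ((a j + (b ⟨0, hm⟩ - a ⟨0, hm⟩) * x j : ℕ) : ℝ) := by
      rw [e j, ← ha]
      push_cast [hlt.le]
      rw [hi]
      ring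
    exact_mod_cast this.symm

theorem card_le_rkm {k m N : ℕ} {A : Finset (Fin m → ℕ)} (hA : PatchFree k A)
    (h : A ⊆ Finset.Icc (fun _ => 1) (fun _ => N)) : A.card ≤ rkm k m N := by
  classical
  exact Finset.le_sup (f := Finset.card) (by simp [hA, h])

theorem patchFree_singleton {k m : ℕ} (hk : 2 ≤ k) (hm : 1 ≤ m) (c : Fin m → ℕ) :
    PatchFree k {c} := by
  rw [patchFree_iff hk hm]
  intro a p hp
  by_contra! h
  simp only [Finset.mem_singleton] at h
  have h0 := congrFun (h fun _ => ⟨0, by omega⟩) ⟨0, hm⟩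
  have h1 := congrFun (h fun _ => ⟨1, by omega⟩) ⟨0, hm⟩
  simp at h0 h1
  omega

theorem one_le_rkm {k m N : ℕ} (hk : 2 ≤ k) (hm : 1 ≤ m) (hN : 1 ≤ N) : 1 ≤ rkm k m N := by
  have := card_le_rkm (N := N) (patchFree_singleton hk hm fun _ => 1)
    (by simp [Pi.le_def, hN])
  simpa using this

theorem exists_card_eq_rkm {k m N : ℕ} (hk : 2 ≤ k) (hm : 1 ≤ m) (hN : 1 ≤ N) :
    ∃ A ⊆ Finset.Icc (fun _ : Fin m => 1) (fun _ => N), PatchFree k A ∧ A.card = rkm k m N := by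
  classical
  obtain ⟨A, hA, e⟩ := Finset.exists_mem_eq_sup
    ((Finset.Icc (fun _ : Fin m => 1) (fun _ : Fin m => N)).powerset.filter (PatchFree k))
    ⟨{fun _ => 1}, by simp [Pi.le_def, hN, patchFree_singleton hk hm]⟩ Finset.card
  simp only [Finset.mem_filter, Finset.mem_powerset] at hA
  exact ⟨A, hA.1, hA.2, by rw [← e]; unfold rkm; congr⟩

/-! ### Approximate arithmetic progressions -/

theorem containsApproxAP_of_forall_exists {d m k : ℕ} {ε Δ : ℝ} {v : Fin m → Space d}
    {F : Set (Space d)} (hΔ : 0 < Δ) (t : Space d)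
    (h : ∀ x : Fin m → Fin k,
      ∃ y ∈ F, dist (t + Δ • ∑ i, ((x i : ℕ) : ℝ) • v i) y ≤ ε * Δ) :
    ContainsApproxAP k ε v F := by
  refine ⟨F, subset_rfl, _, Δ, ⟨hΔ, t, rfl⟩, ?_⟩
  refine iSup₂_le ?_
  rintro _ ⟨x, rfl⟩
  obtain ⟨y, hy, hd⟩ := h x
  refine (Metric.infEDist_le_edist_of_mem hy).trans ?_
  rw [edist_dist]
  exact ENNReal.ofReal_le_ofReal hd

/-- In a compact set the approximating points of a `(k, ε, v)`-AP are attained. -/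
theorem ContainsApproxAP.exists_of_isCompact {d m k : ℕ} {ε : ℝ} {v : Fin m → Space d}
    {F : Set (Space d)} (hF : IsCompact F) (hne : F.Nonempty) (hε : 0 ≤ ε)
    (h : ContainsApproxAP k ε v F) :
    ∃ (t : Space d) (Δ : ℝ), 0 < Δ ∧ ∀ x : Fin m → Fin k,
      ∃ y ∈ F, dist (t + Δ • ∑ i, ((x i : ℕ) : ℝ) • v i) y ≤ ε * Δ := by
  obtain ⟨Q, hQ, _, Δ, ⟨hΔ, t, rfl⟩, hs⟩ := h
  refine ⟨t, Δ, hΔ, fun x => ?_⟩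
  obtain ⟨y, hy, e⟩ := hF.exists_infEDist_eq_edist hne (t + Δ • ∑ i, ((x i : ℕ) : ℝ) • v i)
  refine ⟨y, hy, ?_⟩
  have h1 := (le_iSup₂ (f := fun z (_ : z ∈ Set.range fun x : Fin m → Fin k =>
    t + Δ • ∑ i, ((x i : ℕ) : ℝ) • v i) => Metric.infEDist z Q) _ ⟨x, rfl⟩).trans hs
  have h2 := (Metric.infEDist_anti hQ).trans h1
  rw [e, edist_dist] at h2
  exact (ENNReal.ofReal_le_ofReal_iff (by positivity)).1 h2

theorem dist_le_sqrt_mul {d : ℕ} {u w : Space d} {η : ℝ} (hη : 0 ≤ η)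
    (h : ∀ i, |u i - w i| ≤ η) : dist u w ≤ √(d : ℝ) * η := by
  rw [EuclideanSpace.dist_eq, Real.sqrt_le_left (by positivity), mul_pow,
    Real.sq_sqrt (by positivity)]
  calc ∑ i, dist (u i) (w i) ^ 2 ≤ ∑ _i : Fin d, η ^ 2 :=
        Finset.sum_le_sum fun i _ => by
          rw [Real.dist_eq]
          exact pow_le_pow_left₀ (abs_nonneg _) (h i) 2
    _ = d * η ^ 2 := by simp

/-! ### Counting the cells met by a set without approximate progressions -/

section Counting

variable {d m k N : ℕ} {h : m ≤ d} {ε : ℝ} {F : Set (Space d)}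
  {b : OrthonormalBasis (Fin d) ℝ (Space d)}

/-- If a cube is cut into `N ^ 2` parts per side, then `F` meets at most
`N ^ d * (N ^ (d - m) * rkm k m N)` of the cells. The cells whose indices are in a fixed residue
class modulo `N` form a grid of step `N` cell sides, and an error of one cell diameter is at most
`ε` times that step; so for fixed last `d - m` coordinates the first `m` coordinates of the cells
met by `F` form a patch-free set. -/
theorem card_cells_le (hk : 2 ≤ k) (hm : 1 ≤ m)
    (hF : ¬ ContainsApproxAP k ε (fun i => b (Fin.castLE h i)) F) (hN : 1 ≤ N)
    (hNε : √(d : ℝ) ≤ ε * N) {η : ℝ} (hη : 0 < η) (o : Fin d → ℝ) (S : Finset (Fin d → ℕ))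
    (hS : ∀ z ∈ S, (∀ i, z i < N ^ 2) ∧
      ∃ y ∈ F, ∀ i, o i + η * z i ≤ b.repr y i ∧ b.repr y i < o i + η * z i + η) :
    S.card ≤ N ^ d * (N ^ (d - m) * rkm k m N) := by
  classical
  let f : (Fin d → ℕ) → (Fin d → ℕ) × (Fin (d - m) → ℕ) :=
    fun z => (fun i => z i % N, fun j => z (tailIdx h j) / N)
  let T : Finset ((Fin d → ℕ) × (Fin (d - m) → ℕ)) :=
    Fintype.piFinset (fun _ => Finset.range N) ×ˢ Fintype.piFinset (fun _ => Finset.range N)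
  have hdiv : ∀ z ∈ S, ∀ i, z i / N < N := fun z hz i => by
    rw [Nat.div_lt_iff_lt_mul hN, ← sq]
    exact (hS z hz).1 i
  have hmaps : ∀ z ∈ S, f z ∈ T := by
    intro z hz
    simp only [f, T, Finset.mem_product, Fintype.mem_piFinset, Finset.mem_range]
    exact ⟨fun i => Nat.mod_lt _ hN, fun j => hdiv z hz _⟩
  have hfib : ∀ c ∈ T, (S.filter fun z => f z = c).card ≤ rkm k m N := by
    rintro ⟨ρ, q⟩ -
    let g : (Fin d → ℕ) → Fin m → ℕ := fun z i => z (Fin.castLE h i) / N + 1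
    have hfz : ∀ z, f z = (ρ, q) → (∀ i, z i % N = ρ i) ∧ ∀ j, z (tailIdx h j) / N = q j := by
      intro z hz
      simp only [f, Prod.mk.injEq, funext_iff] at hz
      exact hz
    have hinj : Set.InjOn g (S.filter fun z => f z = (ρ, q)) := by
      intro z hz w hw e
      simp only [Finset.coe_filter, Set.mem_ofPred_eq] at hz hw
      obtain ⟨hz1, hz2⟩ := hfz z hz.2
      obtain ⟨hw1, hw2⟩ := hfz w hw.2
      have hq : ∀ i, z i / N = w i / N := by
        intro i
        obtain ⟨j, rfl⟩ | ⟨j, rfl⟩ := eq_castLE_or_eq_tailIdx h i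
        · have := congrFun e j
          simpa [g] using this
        · rw [hz2, hw2]
      ext i
      rw [← Nat.div_add_mod (z i) N, ← Nat.div_add_mod (w i) N, hq, hz1, hw1]
    rw [← Finset.card_image_of_injOn hinj]
    apply card_le_rkm
    · rw [patchFree_iff hk hm]
      intro a p hp
      by_contra! hc
      simp only [Finset.mem_image, Finset.mem_filter] at hc
      choose z hz hgz using hc
      let x₀ : Fin m → Fin k := fun _ => ⟨0, by omega⟩
      have hz0 : ∀ x j, (z x (Fin.castLE h j) : ℝ) =
          z x₀ (Fin.castLE h j) + N * (p * ((x j : ℕ) : ℝ)) := by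
        intro x j
        have e1 := congrFun (hgz x) j
        have e0 := congrFun (hgz x₀) j
        simp only [g, x₀, mul_zero, add_zero] at e1 e0
        have m1 := Nat.div_add_mod (z x (Fin.castLE h j)) N
        have m0 := Nat.div_add_mod (z x₀ (Fin.castLE h j)) N
        rw [(hfz _ (hz x).2).1] at m1
        rw [(hfz _ (hz x₀).2).1] at m0
        have e2 : z x (Fin.castLE h j) / N = z x₀ (Fin.castLE h j) / N + p * x j := by
          simp only [x₀]
          omega
        rw [← m1, ← m0, e2]
        push_cast
        ring
      have hz1 : ∀ x j, z x (tailIdx h j) = z x₀ (tailIdx h j) := by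
        intro x j
        rw [← Nat.div_add_mod (z x (tailIdx h j)) N, ← Nat.div_add_mod (z x₀ (tailIdx h j)) N,
          (hfz _ (hz x).2).1, (hfz _ (hz x).2).2, (hfz _ (hz x₀).2).1, (hfz _ (hz x₀).2).2]
      have hNp : (1 : ℝ) ≤ p := by exact_mod_cast hp
      have hN0 : (0 : ℝ) < N := by exact_mod_cast hN
      refine hF (containsApproxAP_of_forall_exists (Δ := η * N * p) (by positivity)
        (b.repr.symm (WithLp.toLp 2 fun i => o i + η * z x₀ i)) fun x => ?_)
      obtain ⟨y, hy, hyz⟩ := (hS _ (hz x).1).2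
      refine ⟨y, hy, ?_⟩
      have hrepr : b.repr (b.repr.symm (WithLp.toLp 2 fun i => o i + η * z x₀ i) +
          (η * N * p) • ∑ i, ((x i : ℕ) : ℝ) • b (Fin.castLE h i)) =
          (WithLp.toLp 2 fun i => o i + η * z x₀ i) +
          (η * N * p) • ∑ i, ((x i : ℕ) : ℝ) • stdVec h i := by
        simp [stdVec]
      have hd : dist (b.repr.symm (WithLp.toLp 2 fun i => o i + η * z x₀ i) +
          (η * N * p) • ∑ i, ((x i : ℕ) : ℝ) • b (Fin.castLE h i)) y ≤ √(d : ℝ) * η := by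
        rw [← b.repr.dist_map, hrepr]
        refine dist_le_sqrt_mul hη.le fun i => ?_
        have hi := hyz i
        obtain ⟨j, rfl⟩ | ⟨j, rfl⟩ := eq_castLE_or_eq_tailIdx h i
        · rw [patchPoint_castLE]
          rw [hz0 x j] at hi
          rw [abs_le]
          simp only
          constructor <;> linarith
        · rw [patchPoint_tailIdx]
          rw [hz1 x j] at hi
          rw [abs_le]
          simp only
          constructor <;> linarith
      calc _ ≤ √(d : ℝ) * η := hd
        _ ≤ ε * N * η := by gcongr
        _ = ε * N * η * 1 := by ring
        _ ≤ ε * N * η * p := by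
          have : 0 ≤ ε * N := (Real.sqrt_nonneg _).trans hNε
          gcongr
        _ = ε * (η * N * p) := by ring
    · intro w hw
      simp only [Finset.mem_image, Finset.mem_filter] at hw
      obtain ⟨z, ⟨hz, -⟩, rfl⟩ := hw
      simp only [Finset.mem_Icc, Pi.le_def, g]
      exact ⟨fun i => Nat.le_add_left 1 _, fun i => hdiv z hz _⟩
  calc S.card ≤ rkm k m N * T.card := Finset.card_le_mul_card_image_of_maps_to hmaps _ hfib
    _ = N ^ d * (N ^ (d - m) * rkm k m N) := by
      simp only [T, Finset.card_product, Fintype.card_piFinset_const, Finset.card_range]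
      ring

/-- `E` is covered by at most `n` sets of diameter at most `r`. -/
def HasCover {X : Type*} [PseudoEMetricSpace X] (E : Set X) (r : ℝ) (n : ℕ) : Prop :=
  ∃ 𝒰 : Finset (Set X), 𝒰.card ≤ n ∧ E ⊆ ⋃₀ (𝒰 : Set (Set X)) ∧
    ∀ U ∈ 𝒰, Metric.ediam U ≤ ENNReal.ofReal r

theorem HasCover.coverNumber_le {X : Type*} [PseudoEMetricSpace X] {E : Set X} {r : ℝ} {n : ℕ}
    (hE : HasCover E r n) : coverNumber E r ≤ n := by
  obtain ⟨𝒰, hc, hs, hd⟩ := hE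
  refine (iInf₂_le (𝒰 : Set (Set X)) ⟨hs, hd⟩).trans ?_
  rw [Set.encard_coe_eq_coe_finsetCard]
  exact_mod_cast hc

/-- Iterating `card_cells_le`: a part of `F` in a cube whose side is `(N ^ 2) ^ j` times `η` is
covered by `M ^ j` pieces of cubes of side `η`, where `M` is the one-step bound. -/
theorem hasCover_of_mem_cube (hk : 2 ≤ k) (hm : 1 ≤ m)
    (hF : ¬ ContainsApproxAP k ε (fun i => b (Fin.castLE h i)) F) (hN : 1 ≤ N)
    (hNε : √(d : ℝ) ≤ ε * N) {η : ℝ} (hη : 0 < η) (j : ℕ) :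
    ∀ (E : Set (Space d)) (o : Fin d → ℝ), E ⊆ F →
      (∀ y ∈ E, ∀ i, o i ≤ b.repr y i ∧ b.repr y i < o i + η * ((N : ℝ) ^ 2) ^ j) →
      HasCover E (√(d : ℝ) * η) ((N ^ d * (N ^ (d - m) * rkm k m N)) ^ j) := by
  classical
  induction j with
  | zero =>
    intro E o _ hE
    refine ⟨{E}, by simp, by simp, ?_⟩
    simp only [Finset.mem_singleton, forall_eq]
    refine Metric.ediam_le fun y hy w hw => ?_
    rw [edist_dist, ← b.repr.dist_map]
    refine ENNReal.ofReal_le_ofReal (dist_le_sqrt_mul hη.le fun i => ?_)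
    have h1 := hE y hy i
    have h2 := hE w hw i
    rw [abs_le]
    simp only [pow_zero, mul_one] at h1 h2
    constructor <;> linarith
  | succ j ih =>
    intro E o hEF hE
    have hN0 : (0 : ℝ) < N := by exact_mod_cast hN
    set η' : ℝ := η * ((N : ℝ) ^ 2) ^ j with hη'
    have hη'0 : 0 < η' := by positivity
    let cell : (Fin d → ℕ) → Set (Space d) := fun z =>
      {y ∈ E | ∀ i, o i + η' * z i ≤ b.repr y i ∧ b.repr y i < o i + η' * z i + η'}
    let S : Finset (Fin d → ℕ) :=
      (Fintype.piFinset fun _ => Finset.range (N ^ 2)).filter fun z => (cell z).Nonempty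
    have hcard : S.card ≤ N ^ d * (N ^ (d - m) * rkm k m N) := by
      refine card_cells_le hk hm hF hN hNε hη'0 o S fun z hz => ?_
      simp only [S, Finset.mem_filter, Fintype.mem_piFinset, Finset.mem_range] at hz
      obtain ⟨hz, y, hy, hyz⟩ := hz
      exact ⟨hz, y, hEF hy, hyz⟩
    have hcov : ∀ z, HasCover (cell z) (√(d : ℝ) * η)
        ((N ^ d * (N ^ (d - m) * rkm k m N)) ^ j) := fun z =>
      ih (cell z) (fun i => o i + η' * z i) (fun y hy => hEF hy.1) fun y hy => hy.2
    choose 𝒰 hc hs hd using hcov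
    refine ⟨S.biUnion 𝒰, ?_, ?_, ?_⟩
    · rw [pow_succ']
      exact (Finset.card_biUnion_le_card_mul _ _ _ fun z _ => hc z).trans
        (Nat.mul_le_mul_right _ hcard)
    · intro y hy
      have hnn : ∀ i, 0 ≤ (b.repr y i - o i) / η' := fun i =>
        div_nonneg (by linarith [(hE y hy i).1]) hη'0.le
      let z : Fin d → ℕ := fun i => ⌊(b.repr y i - o i) / η'⌋₊
      have hyz : y ∈ cell z := by
        refine ⟨hy, fun i => ?_⟩
        have h1 := Nat.floor_le (hnn i)
        have h2 := Nat.lt_floor_add_one ((b.repr y i - o i) / η')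
        rw [le_div_iff₀ hη'0] at h1
        rw [div_lt_iff₀ hη'0] at h2
        simp only [z]
        constructor <;> linarith
      have hzS : z ∈ S := by
        simp only [S, Finset.mem_filter, Fintype.mem_piFinset, Finset.mem_range]
        refine ⟨fun i => ?_, y, hyz⟩
        have h1 := (hE y hy i).2
        rw [Nat.floor_lt (hnn i), div_lt_iff₀ hη'0]
        rw [pow_succ] at h1
        push_cast
        linarith [show (N : ℝ) ^ 2 * η' = η * (((N : ℝ) ^ 2) ^ j * (N : ℝ) ^ 2) by
          rw [hη']; ring]
      obtain ⟨U, hU, hyU⟩ := hs z hyz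
      exact ⟨U, by simpa using ⟨z, hzS, hU⟩, hyU⟩
    · intro U hU
      obtain ⟨z, -, hU⟩ := Finset.mem_biUnion.1 hU
      exact hd z U hU

end Counting

/-! ### The upper bound for the Assouad dimension -/

/-- The exponent is `log M / log (N ^ 2)`, where `M` bounds the number of cells of relative size
`N ^ (-2)` that meet `F`. -/
theorem assouadDim_le_of_not_containsApproxAP {d m k N : ℕ} (hd : 1 ≤ d) (h : m ≤ d) (hk : 2 ≤ k)
    (hm : 1 ≤ m) {ε : ℝ} {F : Set (Space d)} {v : Fin m → Space d} (hv : Orthonormal ℝ v)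
    (hF : ¬ ContainsApproxAP k ε v F) (hN : 2 ≤ N) (hNε : √(d : ℝ) ≤ ε * N) :
    assouadDim F ≤ ENNReal.ofReal
      (Real.logb ((N : ℝ) ^ 2) ((N ^ d * (N ^ (d - m) * rkm k m N) : ℕ) : ℝ)) := by
  obtain ⟨b, rfl⟩ : ∃ b : OrthonormalBasis (Fin d) ℝ (Space d),
      v = fun i => b (Fin.castLE h i) := by
    let w : Fin d → Space d := fun i => if hi : (i : ℕ) < m then v ⟨i, hi⟩ else 0
    have hw : Orthonormal ℝ (({i : Fin d | (i : ℕ) < m}).domRestrict w) := by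
      have := hv.comp (fun i : {i : Fin d | (i : ℕ) < m} => (⟨i, i.2⟩ : Fin m))
        (fun i j hij => by
          have := congrArg Fin.val hij
          simp only at this
          exact Subtype.ext (Fin.ext this))
      convert! this using 1
      ext1 i
      have hi : ((i : Fin d) : ℕ) < m := i.2
      simp [w, hi]
    obtain ⟨b, hb⟩ := hw.exists_orthonormalBasis_extension_of_card_eq (by simp)
    refine ⟨b, ?_⟩
    ext1 i
    rw [hb (Fin.castLE h i) (by simp)]
    simp [w]
  set M : ℕ := N ^ d * (N ^ (d - m) * rkm k m N) with hM
  have hN0 : 0 < N := by omega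
  have hM1 : 1 ≤ M := by
    have := one_le_rkm hk hm (N := N) hN0
    exact Nat.mul_pos (by positivity) (Nat.mul_pos (by positivity) this)
  have hM1' : (1 : ℝ) ≤ M := by exact_mod_cast hM1
  have hN1 : (1 : ℝ) < (N : ℝ) ^ 2 := one_lt_pow₀ (by exact_mod_cast hN) (by norm_num)
  set σ : ℝ := Real.logb ((N : ℝ) ^ 2) M with hσ
  have hσ0 : 0 ≤ σ := Real.logb_nonneg hN1 hM1'
  have hMσ : ((N : ℝ) ^ 2) ^ σ = M := Real.rpow_logb (by positivity) hN1.ne' (by positivity)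
  have hsd : 1 ≤ √(d : ℝ) := by
    rw [Real.one_le_sqrt]
    exact_mod_cast hd
  -- `B(x, R)` lies in a half-open cube of side `3 R`, and cubes of side `r / √d` have diameter at
  -- most `r`; the number of steps `n + 1` is the least that reaches this side.
  refine iInf₂_le σ.toNNReal ⟨M * (3 * √(d : ℝ)) ^ σ, by positivity, fun r hr R hR x _ => ?_⟩
  rw [Real.coe_toNNReal _ hσ0]
  have hR0 : 0 < R := hr.trans hR
  obtain ⟨n, hn1, hn2⟩ := exists_nat_pow_near (x := 3 * √(d : ℝ) * (R / r)) (y := (N : ℝ) ^ 2)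
    (by
      have : 1 ≤ R / r := (one_le_div hr).2 hR.le
      nlinarith) hN1
  have hcov : HasCover (Metric.closedBall x R ∩ F) r (M ^ (n + 1)) := by
    have := hasCover_of_mem_cube hk hm hF hN0 hNε (η := r / √(d : ℝ)) (by positivity) (n + 1)
      (Metric.closedBall x R ∩ F) (fun i => b.repr x i - R) Set.inter_subset_right
      (fun y hy i => by
        have h1 : |b.repr y i - b.repr x i| ≤ R := by
          have := PiLp.norm_apply_le (b.repr y - b.repr x) i
          rw [← dist_eq_norm, b.repr.dist_map] at this
          exact this.trans hy.1
        rw [abs_le] at h1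
        have h2 : 3 * R < r / √(d : ℝ) * ((N : ℝ) ^ 2) ^ (n + 1) := by
          calc 3 * R = r / √(d : ℝ) * (3 * √(d : ℝ) * (R / r)) := by field_simp
            _ < _ := by gcongr
        constructor <;> linarith)
    rwa [mul_div_cancel₀ _ (by positivity)] at this
  have hle : ((M ^ (n + 1) : ℕ) : ℝ) ≤ M * (3 * √(d : ℝ)) ^ σ * (R / r) ^ σ := by
    push_cast
    rw [pow_succ', mul_assoc, ← Real.mul_rpow (by positivity) (by positivity)]
    gcongr
    calc (M : ℝ) ^ n = (((N : ℝ) ^ 2) ^ n) ^ σ := by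
          rw [← hMσ, Real.rpow_pow_comm (by positivity)]
      _ ≤ _ := by gcongr
  calc ((coverNumber (Metric.closedBall x R ∩ F) r : ℕ∞) : ℝ≥0∞)
      ≤ (((M ^ (n + 1) : ℕ) : ℕ∞) : ℝ≥0∞) := by
        exact_mod_cast hcov.coverNumber_le
    _ = ENNReal.ofReal ((M ^ (n + 1) : ℕ) : ℝ) := by
        rw [ENat.toENNReal_coe, ENNReal.ofReal_natCast]
    _ ≤ _ := ENNReal.ofReal_le_ofReal hle

theorem logb_cellCount_eq {d m r N : ℕ} (h : m ≤ d) (hr : 1 ≤ r) (hN : 2 ≤ N) :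
    Real.logb ((N : ℝ) ^ 2) ((N ^ d * (N ^ (d - m) * r) : ℕ) : ℝ) =
      d + 1 / 2 * (Real.log ((r : ℝ) / (N : ℝ) ^ m) / Real.log N) := by
  have hN0 : (0 : ℝ) < N := by exact_mod_cast (show 0 < N by omega)
  have hr0 : (0 : ℝ) < r := by exact_mod_cast hr
  have hlog : 0 < Real.log N := Real.log_pos (by exact_mod_cast hN)
  push_cast
  rw [Real.logb, Real.log_mul (by positivity) (by positivity),
    Real.log_mul (by positivity) (by positivity), Real.log_div (by positivity) (by positivity),
    Real.log_pow, Real.log_pow, Real.log_pow, Real.log_pow, Nat.cast_sub h]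
  field_simp
  push_cast
  ring

theorem DA_le {d m k N : ℕ} (hd : 1 ≤ d) (h : m ≤ d) (hk : 2 ≤ k) (hm : 1 ≤ m) {ε : ℝ}
    (hN : 2 ≤ N) (hNε : √(d : ℝ) ≤ ε * N) :
    ((DA k ε d m : ℝ≥0∞) : EReal) ≤ ((d + 1 / 2 *
      (Real.log ((rkm k m N : ℝ) / (N : ℝ) ^ m) / Real.log N) : ℝ) : EReal) := by
  have hr := one_le_rkm hk hm (show 1 ≤ N by omega)
  rw [← logb_cellCount_eq h hr hN]
  have h0 : 0 ≤ Real.logb ((N : ℝ) ^ 2) ((N ^ d * (N ^ (d - m) * rkm k m N) : ℕ) : ℝ) := by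
    refine Real.logb_nonneg (one_lt_pow₀ (by exact_mod_cast hN) (by norm_num)) ?_
    exact_mod_cast Nat.mul_pos (by positivity) (Nat.mul_pos (by positivity) hr)
  rw [← max_eq_left h0, ← EReal.coe_ennreal_ofReal, EReal.coe_ennreal_le_coe_ennreal_iff]
  exact iSup₂_le fun F ⟨v, hv, hF⟩ =>
    assouadDim_le_of_not_containsApproxAP hd h hk hm hv hF hN hNε

/-! ### Comparison of the dimensions -/

/-- An admissible exponent `σ` for the Assouad dimension gives, at a fixed outer radius, covers at
all small scales `r` by at most `C (R / r) ^ σ` sets, so the `σ`-dimensional Hausdorff measure is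
finite. -/
theorem dimH_le_assouadDim {d : ℕ} {F : Set (Space d)} (hF : Bornology.IsBounded F) :
    dimH F ≤ assouadDim F := by
  obtain rfl | ⟨x, hx⟩ := F.eq_empty_or_nonempty
  · simp
  refine le_iInf₂ fun σ ⟨C, hC, hcov⟩ => ?_
  obtain ⟨R, hR0, hR⟩ := hF.subset_closedBall_lt 1 x
  have hball : Metric.closedBall x R ∩ F = F := Set.inter_eq_right.2 hR
  have hr : ∀ n : ℕ, (0 : ℝ) < 1 / ((n : ℝ) + 1) := fun n => by positivity
  have key : ∀ n : ℕ, ∃ 𝒰 : Finset (Set (Space d)), F ⊆ ⋃₀ (𝒰 : Set (Set (Space d))) ∧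
      (∀ U ∈ 𝒰, Metric.ediam U ≤ ENNReal.ofReal (1 / ((n : ℝ) + 1))) ∧
      (𝒰.card : ℝ≥0∞) ≤ ENNReal.ofReal (C * (R / (1 / ((n : ℝ) + 1))) ^ (σ : ℝ)) := by
    intro n
    have hn := hcov _ (hr n) R (lt_of_le_of_lt
      (by rw [div_le_one (by positivity)]; linarith [n.cast_nonneg (α := ℝ)]) hR0) x hx
    rw [hball] at hn
    have hfin : coverNumber F (1 / ((n : ℝ) + 1)) < ⊤ := by
      have := hn.trans_lt ENNReal.ofReal_lt_top
      exact_mod_cast this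
    have hlt : coverNumber F (1 / ((n : ℝ) + 1)) < coverNumber F (1 / ((n : ℝ) + 1)) + 1 :=
      ENat.lt_add_one_iff hfin.ne |>.2 le_rfl
    conv_lhs at hlt => unfold coverNumber
    simp only [iInf_lt_iff] at hlt
    obtain ⟨𝒰, ⟨hs, hd⟩, hlt⟩ := hlt
    have hle := (ENat.lt_add_one_iff hfin.ne).1 hlt
    have hfin' : 𝒰.Finite := Set.encard_lt_top_iff.1 (hle.trans_lt hfin)
    lift 𝒰 to Finset (Set (Space d)) using hfin'
    refine ⟨𝒰, hs, hd, le_trans ?_ hn⟩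
    rw [Set.encard_coe_eq_coe_finsetCard] at hle
    exact_mod_cast hle
  choose 𝒰 hs hd hc using key
  refine dimH_le_of_hausdorffMeasure_ne_top (ne_top_of_le_ne_top
    (ENNReal.ofReal_ne_top (r := C * R ^ (σ : ℝ))) ?_)
  refine (MeasureTheory.Measure.hausdorffMeasure_le_liminf_sum (ι := fun n => 𝒰 n) (σ : ℝ) F
    (l := Filter.atTop) (fun n : ℕ => ENNReal.ofReal (1 / ((n : ℝ) + 1))) ?_
    (fun n U => (U : Set (Space d))) (Filter.Eventually.of_forall fun n U => hd n _ U.2)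
    (Filter.Eventually.of_forall fun n => ?_)).trans ?_
  · rw [← ENNReal.ofReal_zero]
    exact ENNReal.tendsto_ofReal tendsto_one_div_add_atTop_nhds_zero_nat
  · intro y hy
    obtain ⟨U, hU, hyU⟩ := hs n hy
    exact Set.mem_iUnion.2 ⟨⟨U, hU⟩, hyU⟩
  · refine Filter.liminf_le_of_le (by isBoundedDefault) fun B hB => ?_
    obtain ⟨n, hn⟩ := hB.exists
    refine hn.trans ?_
    calc ∑ U : 𝒰 n, Metric.ediam (U : Set (Space d)) ^ (σ : ℝ)
        ≤ ∑ _U : 𝒰 n, ENNReal.ofReal (1 / ((n : ℝ) + 1)) ^ (σ : ℝ) :=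
          Finset.sum_le_sum fun U _ => ENNReal.rpow_le_rpow (hd n _ U.2) σ.2
      _ = (𝒰 n).card * ENNReal.ofReal (1 / ((n : ℝ) + 1)) ^ (σ : ℝ) := by simp
      _ ≤ ENNReal.ofReal (C * (R / (1 / ((n : ℝ) + 1))) ^ (σ : ℝ)) *
            ENNReal.ofReal ((1 / ((n : ℝ) + 1)) ^ (σ : ℝ)) := by
          rw [ENNReal.ofReal_rpow_of_pos (hr n)]
          gcongr
          exact hc n
      _ = ENNReal.ofReal (C * R ^ (σ : ℝ)) := by
          rw [← ENNReal.ofReal_mul (by positivity), mul_assoc, ← Real.mul_rpow (by positivity)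
            (by positivity), div_mul_cancel₀ _ (hr n).ne']

theorem DS_le_DA {d m k : ℕ} (h : m ≤ d) (ε : ℝ) : DS k ε h ≤ DA k ε d m :=
  iSup₂_le fun F ⟨hF, hAP⟩ => (dimH_le_assouadDim hF.1.isBounded).trans
    (le_iSup₂ (f := fun (F : Set (Space d)) (_ : ∃ v : Fin m → Space d,
      Orthonormal ℝ v ∧ ¬ ContainsApproxAP k ε v F) => assouadDim F) F
      ⟨stdVec h, orthonormal_stdVec h, hAP⟩)

theorem IsSelfSimilarOSC.isAttractorOSC {d : ℕ} {F : Set (Space d)} (hF : IsSelfSimilarOSC F) :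
    IsAttractorOSC F := by
  obtain ⟨hc, hne, n, f, hf, hV, e⟩ := hF
  refine ⟨hc, hne, n, f, fun i => ?_, hV, e⟩
  obtain ⟨c, hc0, hc1, hfc⟩ := hf i
  refine ⟨⟨c, hc0.le⟩, by exact_mod_cast hc1, LipschitzWith.of_dist_le_mul fun x y => ?_⟩
  rw [hfc]
  rfl

theorem DSsim_le_DS {d m k : ℕ} (h : m ≤ d) (ε : ℝ) : DSsim k ε h ≤ DS k ε h :=
  iSup₂_le fun F ⟨hF, hAP⟩ =>
    le_iSup₂ (f := fun (F : Set (Space d))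
      (_ : IsAttractorOSC F ∧ ¬ ContainsApproxAP k ε (stdVec h) F) => dimH F) F
      ⟨hF.isAttractorOSC, hAP⟩

/-! ### Self-similar sets with a common contraction ratio -/

/-- The point with code `ω` of the attractor of the maps `x ↦ τ i + c • x`. -/
noncomputable def codePoint {ι : Type*} {d : ℕ} (c : ℝ) (τ : ι → Space d) (ω : ℕ → ι) : Space d :=
  ∑' j, c ^ j • τ (ω j)

section CodePoint

variable {d n : ℕ} {c : ℝ} {τ : Fin n → Space d}

theorem norm_pow_smul_le (hc0 : 0 < c) (ω : ℕ → Fin n) (j : ℕ) :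
    ‖c ^ j • τ (ω j)‖ ≤ c ^ j * ∑ i, ‖τ i‖ := by
  rw [norm_smul, norm_pow, Real.norm_of_nonneg hc0.le]
  gcongr
  exact Finset.single_le_sum (f := fun i => ‖τ i‖) (fun i _ => norm_nonneg _)
    (Finset.mem_univ (ω j))

theorem summable_codePoint (hc0 : 0 < c) (hc1 : c < 1) (ω : ℕ → Fin n) :
    Summable fun j => c ^ j • τ (ω j) :=
  Summable.of_norm_bounded ((summable_geometric_of_lt_one hc0.le hc1).mul_right _)
    (norm_pow_smul_le hc0 ω)

theorem continuous_codePoint (hc0 : 0 < c) (hc1 : c < 1) :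
    Continuous (codePoint c τ) := by
  refine continuous_tsum (fun j => ?_)
    ((summable_geometric_of_lt_one hc0.le hc1).mul_right (∑ i, ‖τ i‖))
    fun j ω => norm_pow_smul_le hc0 ω j
  have hτ : Continuous τ := continuous_of_discreteTopology
  fun_prop

/-- The self-similarity relation. -/
theorem codePoint_eq_add_smul (hc0 : 0 < c) (hc1 : c < 1) (ω : ℕ → Fin n) :
    codePoint c τ ω = τ (ω 0) + c • codePoint c τ fun j => ω (j + 1) := by
  unfold codePoint
  rw [(summable_codePoint hc0 hc1 ω).tsum_eq_zero_add,
    ← (summable_codePoint hc0 hc1 fun j => ω (j + 1)).tsum_const_smul]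
  simp [pow_succ', mul_smul]

theorem codePoint_mem_unitCube (hc0 : 0 < c) (hc1 : c < 1)
    (hτ : ∀ i l, 0 ≤ τ i l ∧ τ i l ≤ 1 - c) (ω : ℕ → Fin n) (l : Fin d) :
    0 ≤ codePoint c τ ω l ∧ codePoint c τ ω l ≤ 1 := by
  have hs := summable_codePoint (τ := τ) hc0 hc1 ω
  have e : codePoint c τ ω l = ∑' j, c ^ j * τ (ω j) l :=
    (EuclideanSpace.proj l : Space d →L[ℝ] ℝ).map_tsum hs
  have hs' : Summable fun j => c ^ j * τ (ω j) l :=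
    (EuclideanSpace.proj l : Space d →L[ℝ] ℝ).summable hs
  have hg := summable_geometric_of_lt_one hc0.le hc1
  rw [e]
  refine ⟨tsum_nonneg fun j => mul_nonneg (by positivity) (hτ _ _).1, ?_⟩
  calc ∑' j, c ^ j * τ (ω j) l ≤ ∑' j, c ^ j * (1 - c) :=
        hs'.tsum_le_tsum (fun j => by gcongr; exact (hτ _ _).2) (hg.mul_right _)
    _ = 1 := by
        rw [tsum_mul_right, tsum_geometric_of_lt_one hc0.le hc1,
          inv_mul_cancel₀ (by linarith)]

theorem codePoint_sub_codePoint (hc0 : 0 < c) (hc1 : c < 1) (p : ℕ) :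
    ∀ {ω ω' : ℕ → Fin n}, (∀ j < p, ω j = ω' j) → codePoint c τ ω - codePoint c τ ω' =
      c ^ p • (codePoint c τ (fun j => ω (j + p)) - codePoint c τ fun j => ω' (j + p)) := by
  induction p with
  | zero => simp
  | succ p ih =>
    intro ω ω' h
    rw [codePoint_eq_add_smul hc0 hc1 ω, codePoint_eq_add_smul hc0 hc1 ω', h 0 (by omega),
      add_sub_add_left_eq_sub, ← smul_sub, ih fun j hj => h (j + 1) (by omega), pow_succ', mul_smul]
    simp only [add_assoc]

theorem isSelfSimilarOSC_range_codePoint [NeZero n] (hc0 : 0 < c) (hc1 : c < 1)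
    (hτ : ∀ i l, 0 ≤ τ i l ∧ τ i l ≤ 1 - c)
    (hsep : Pairwise fun i j => ∃ l, c ≤ |τ i l - τ j l|) :
    IsSelfSimilarOSC (Set.range (codePoint c τ)) := by
  refine ⟨isCompact_range (continuous_codePoint hc0 hc1), Set.range_nonempty _, n,
    fun i x => τ i + c • x, fun i => ⟨c, hc0, hc1, fun x y => ?_⟩,
    ⟨{x | ∀ l, 0 < x l ∧ x l < 1}, ?_, ?_, ?_, ?_, ?_⟩, ?_⟩
  · rw [dist_add_left, dist_smul₀, Real.norm_of_nonneg hc0.le]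
  · simp only [Set.ofPred_forall]
    refine isOpen_iInter_of_finite fun l => ?_
    have hl : Continuous fun x : Space d => x l := by fun_prop
    exact (isOpen_lt continuous_const hl).inter (isOpen_lt hl continuous_const)
  · exact ⟨WithLp.toLp 2 fun _ => 1 / 2, fun l => by norm_num⟩
  · refine (Metric.isBounded_closedBall (x := (0 : Space d)) (r := √(d : ℝ) * 1)).subset ?_
    intro x hx
    refine dist_le_sqrt_mul zero_le_one fun l => ?_
    have := hx l
    rw [abs_le]
    simp only [PiLp.zero_apply]
    constructor <;> linarith
  · rintro i _ ⟨x, hx, rfl⟩ l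
    have h1 := hτ i l
    have h2 := hx l
    simp only [PiLp.add_apply, PiLp.smul_apply, smul_eq_mul]
    constructor <;> nlinarith
  · intro i j hij
    rw [Set.disjoint_left]
    rintro _ ⟨x, hx, rfl⟩ ⟨y, hy, e⟩
    obtain ⟨l, hl⟩ := hsep hij
    have e1 := congrArg (fun z : Space d => z l) e
    simp only [PiLp.add_apply, PiLp.smul_apply, smul_eq_mul] at e1
    have h1 := hx l
    have h2 := hy l
    refine absurd hl (not_le.2 ?_)
    rw [abs_lt]
    constructor <;> nlinarith
  · ext y
    simp only [Set.mem_iUnion, Set.mem_image, Set.mem_range]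
    constructor
    · rintro ⟨ω, rfl⟩
      exact ⟨ω 0, _, ⟨_, rfl⟩, (codePoint_eq_add_smul hc0 hc1 ω).symm⟩
    · rintro ⟨i, _, ⟨ω, rfl⟩, rfl⟩
      exact ⟨fun j => Nat.casesOn j i ω, codePoint_eq_add_smul hc0 hc1 _⟩

/-- Codes that first differ at position `p` give points at distance at least `δ * c ^ p`. -/
theorem le_dist_codePoint {δ : ℝ} (hc0 : 0 < c) (hc1 : c < 1)
    (hτ : ∀ i l, 0 ≤ τ i l ∧ τ i l ≤ 1 - c)
    (hsep : Pairwise fun i j => ∃ l, c + δ ≤ |τ i l - τ j l|) {ω ω' : ℕ → Fin n} {p : ℕ}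
    (h : ∀ j < p, ω j = ω' j) (hp : ω p ≠ ω' p) :
    δ * c ^ p ≤ dist (codePoint c τ ω) (codePoint c τ ω') := by
  rw [dist_eq_norm, codePoint_sub_codePoint hc0 hc1 p h, norm_smul, norm_pow,
    Real.norm_of_nonneg hc0.le, mul_comm]
  gcongr
  obtain ⟨l, hl⟩ := hsep hp
  rw [codePoint_eq_add_smul hc0 hc1 fun j => ω (j + p),
    codePoint_eq_add_smul hc0 hc1 fun j => ω' (j + p)]
  simp only [zero_add]
  have h1 := codePoint_mem_unitCube hc0 hc1 hτ (fun j => ω (j + 1 + p)) l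
  have h2 := codePoint_mem_unitCube hc0 hc1 hτ (fun j => ω' (j + 1 + p)) l
  refine le_trans ?_ (PiLp.norm_apply_le _ l)
  simp only [PiLp.sub_apply, PiLp.add_apply, PiLp.smul_apply, smul_eq_mul, Real.norm_eq_abs]
  rcases le_abs.1 hl with hl | hl
  · refine le_trans ?_ (le_abs_self _)
    nlinarith
  · refine le_trans ?_ (neg_le_abs _)
    nlinarith

/-- Reading the code of a point as the digits of a number in base `n` is a Hölder map of exponent
`log n / log (1 / c)` onto `[0, 1]`. -/
theorem le_dimH_range_codePoint {δ : ℝ} (hδ : 0 < δ) (hn : 1 ≤ n) (hc0 : 0 < c) (hc1 : c < 1)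
    (hτ : ∀ i l, 0 ≤ τ i l ∧ τ i l ≤ 1 - c)
    (hsep : Pairwise fun i j => ∃ l, c + δ ≤ |τ i l - τ j l|) :
    ENNReal.ofReal (Real.log n / Real.log (1 / c)) ≤ dimH (Set.range (codePoint c τ)) := by
  obtain rfl | hn1 := hn.eq_or_lt
  · simp
  have hn1' : (1 : ℝ) < n := by exact_mod_cast hn1
  have hlc : 0 < Real.log (1 / c) := Real.log_pos ((one_lt_div hc0).2 hc1)
  set s : ℝ := Real.log n / Real.log (1 / c) with hs
  have hs0 : 0 < s := div_pos (Real.log_pos hn1') hlc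
  have hcs : c ^ s = (n : ℝ)⁻¹ := by
    rw [Real.rpow_def_of_pos hc0, hs, one_div, Real.log_inv]
    have : Real.log c ≠ 0 := (Real.log_neg hc0 hc1).ne
    rw [show Real.log c * (Real.log n / -Real.log c) = -Real.log n by field_simp,
      Real.exp_neg, Real.exp_log (by linarith)]
  have key : ∀ ω ω' : ℕ → Fin n, |Real.ofDigits ω - Real.ofDigits ω'| ≤
      (1 / δ) ^ s * dist (codePoint c τ ω) (codePoint c τ ω') ^ s := by
    intro ω ω'
    by_cases h : ω = ω'
    · subst h
      simp [Real.zero_rpow hs0.ne']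
    · have hex : ∃ p, ω p ≠ ω' p := Function.ne_iff.1 h
      classical
      have hlt : ∀ j < Nat.find hex, ω j = ω' j := fun j hj => by
        simpa using Nat.find_min hex hj
      have h1 := le_dist_codePoint hc0 hc1 hτ hsep hlt (Nat.find_spec hex)
      refine (Real.abs_ofDigits_sub_ofDigits_le hlt).trans ?_
      rw [← Real.mul_rpow (by positivity) dist_nonneg, ← inv_pow, ← hcs,
        Real.rpow_pow_comm hc0.le]
      gcongr
      rw [one_div, ← div_eq_inv_mul, le_div_iff₀ hδ, mul_comm]
      exact h1
  have hinj : Function.Injective (codePoint c τ) := by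
    intro ω ω' h
    by_contra hne
    have hex : ∃ p, ω p ≠ ω' p := Function.ne_iff.1 hne
    classical
    have h1 := le_dist_codePoint hc0 hc1 hτ hsep
      (fun j hj => by simpa using Nat.find_min hex hj) (Nat.find_spec hex)
    rw [h, dist_self] at h1
    have : 0 < δ * c ^ Nat.find hex := by positivity
    linarith
  have : Nonempty (ℕ → Fin n) := ⟨fun _ => ⟨0, by omega⟩⟩
  let g : Space d → ℝ := fun y => Real.ofDigits (Function.invFun (codePoint c τ) y)
  have hg : ∀ ω, g (codePoint c τ ω) = Real.ofDigits ω := fun ω => by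
    simp only [g, Function.leftInverse_invFun hinj ω]
  have hholder : HolderOnWith ((1 / δ) ^ s).toNNReal s.toNNReal g
      (Set.range (codePoint c τ)) := by
    rintro _ ⟨ω, rfl⟩ _ ⟨ω', rfl⟩
    rw [hg, hg, edist_dist, edist_dist, Real.dist_eq, Real.coe_toNNReal _ hs0.le,
      ENNReal.ofReal_rpow_of_nonneg dist_nonneg hs0.le]
    refine (ENNReal.ofReal_le_ofReal (key ω ω')).trans ?_
    rw [ENNReal.ofReal_mul (by positivity)]
    rfl
  have himg : Set.Icc 0 1 ⊆ g '' Set.range (codePoint c τ) := by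
    intro y hy
    obtain ⟨ω, -, rfl⟩ := Real.ofDigits_SurjOn hn1 hy
    exact ⟨_, ⟨ω, rfl⟩, hg ω⟩
  have hdim : (1 : ℝ≥0∞) ≤ dimH (Set.range (codePoint c τ)) / s.toNNReal := by
    calc (1 : ℝ≥0∞) = dimH (Set.Icc (0 : ℝ) 1) := by
          rw [Real.dimH_of_nonempty_interior (by simp)]
          simp
      _ ≤ _ := (dimH_mono himg).trans (hholder.dimH_image_le (by simpa using hs0))
  rwa [ENNReal.le_div_iff_mul_le (by simp [hs0]) (by simp), one_mul] at hdim

end CodePoint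

/-! ### Self-similar sets without approximate progressions -/

theorem int_eq_zero_of_abs_mul_lt {s : ℝ} (hs : 0 < s) {D : ℤ} (h : |s * D| < s) : D = 0 := by
  rw [abs_mul, abs_of_pos hs] at h
  have h1 : |(D : ℝ)| < 1 := by nlinarith
  have h2 : |D| < 1 := by exact_mod_cast h1
  exact Int.abs_lt_one_iff.1 h2

/-- Points `w x` of the unit cube that lie in cells of side `ε / 4`, at the positions
`7 ε (a i - 1)`, and approximate a patch of size `k` up to `ε Δ`, all lie in the same cell.
Comparing neighbouring points, the second differences of the positions are smaller than the
spacing `7 ε`, so they vanish and the positions themselves form a patch unless they agree. -/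
theorem digit_eq_of_approx_patch {ι : Type*} {d m k : ℕ} (h : m ≤ d) (hk : 2 ≤ k) (hm : 1 ≤ m)
    {ε Δ : ℝ} (hε : 0 < ε) (hε8 : ε < 1 / 8) (hΔ : 0 < Δ) {A : Finset (Fin m → ℕ)}
    (hA : PatchFree k A) {a : ι → Fin d → ℕ} (ha : Function.Injective a)
    (haA : ∀ i, (fun j => a i (Fin.castLE h j)) ∈ A) {ω : (Fin m → Fin k) → ι}
    {u w : (Fin m → Fin k) → Fin d → ℝ} (hu : ∀ x l, 0 ≤ u x l ∧ u x l ≤ 1)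
    (hw : ∀ x l, 0 ≤ w x l ∧ w x l ≤ 1)
    (hwu : ∀ x l, w x l = 7 * ε * (a (ω x) l - 1) + ε / 4 * u x l) (t : Fin d → ℝ)
    (hhead : ∀ x j, |w x (Fin.castLE h j) - (t (Fin.castLE h j) + Δ * (x j : ℕ))| ≤ ε * Δ)
    (htail : ∀ x j, |w x (tailIdx h j) - t (tailIdx h j)| ≤ ε * Δ) (x x' : Fin m → Fin k) :
    ω x = ω x' := by
  let x₀ : Fin m → Fin k := fun _ => ⟨0, by omega⟩
  let x₁ : Fin m → Fin k := fun _ => ⟨1, by omega⟩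
  let j₀ : Fin m := ⟨0, hm⟩
  have hεΔ : ε * Δ < Δ / 8 := by nlinarith
  have h0 := abs_le.1 (hhead x₀ j₀)
  have h1 := abs_le.1 (hhead x₁ j₀)
  simp only [x₀, x₁, Nat.cast_zero, Nat.cast_one, mul_zero, mul_one, add_zero] at h0 h1
  have hΔ43 : Δ ≤ 4 / 3 := by
    have := (hw x₀ (Fin.castLE h j₀)).1
    have := (hw x₁ (Fin.castLE h j₀)).2
    simp only [x₀, x₁] at *
    linarith
  have herr : ε * Δ ≤ ε * (4 / 3) := by gcongr
  have hs : 0 < 7 * ε := by positivity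
  have hbd : ∀ x l, 7 * ε * (a (ω x) l : ℝ) ≤ w x l + 7 * ε ∧
      w x l + 7 * ε ≤ 7 * ε * (a (ω x) l : ℝ) + ε / 4 := by
    intro x l
    have h1 := hu x l
    rw [hwu x l]
    constructor <;> nlinarith
  -- `p` is the candidate for the scale of the patch formed by the positions.
  set p : ℤ := (a (ω x₁) (Fin.castLE h j₀) : ℤ) - a (ω x₀) (Fin.castLE h j₀) with hp
  have hb1 := hbd x₁ (Fin.castLE h j₀)
  have hb0 := hbd x₀ (Fin.castLE h j₀)
  have hpcast : (p : ℝ) = a (ω x₁) (Fin.castLE h j₀) - a (ω x₀) (Fin.castLE h j₀) := by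
    rw [hp]; push_cast; ring
  have hp7 : 7 * ε * (p : ℝ) = 7 * ε * a (ω x₁) (Fin.castLE h j₀) -
      7 * ε * a (ω x₀) (Fin.castLE h j₀) := by rw [hpcast]; ring
  have hp0 : 0 ≤ p := by
    have : -1 < (p : ℝ) := by
      simp only [x₀, x₁] at *
      nlinarith
    have : -1 < p := by exact_mod_cast this
    omega
  have hT : ∀ x y j, a (ω x) (tailIdx h j) = a (ω y) (tailIdx h j) := by
    intro x y j
    have hx := abs_le.1 (htail x j)
    have hy := abs_le.1 (htail y j)
    have hbx := hbd x (tailIdx h j)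
    have hby := hbd y (tailIdx h j)
    have := int_eq_zero_of_abs_mul_lt hs
      (D := (a (ω x) (tailIdx h j) : ℤ) - a (ω y) (tailIdx h j)) (by
        push_cast
        rw [abs_lt, mul_sub]
        constructor <;> linarith)
    omega
  have hsame : ∀ x y j, x j = y j → a (ω x) (Fin.castLE h j) = a (ω y) (Fin.castLE h j) := by
    intro x y j hxy
    have hx := abs_le.1 (hhead x j)
    have hy := abs_le.1 (hhead y j)
    rw [hxy] at hx
    have hbx := hbd x (Fin.castLE h j)
    have hby := hbd y (Fin.castLE h j)
    have := int_eq_zero_of_abs_mul_lt hs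
      (D := (a (ω x) (Fin.castLE h j) : ℤ) - a (ω y) (Fin.castLE h j)) (by
        push_cast
        rw [abs_lt, mul_sub]
        constructor <;> linarith)
    omega
  have hstep : ∀ x y j, (x j : ℕ) = y j + 1 →
      (a (ω x) (Fin.castLE h j) : ℤ) = a (ω y) (Fin.castLE h j) + p := by
    intro x y j hxy
    have hx := abs_le.1 (hhead x j)
    have hy := abs_le.1 (hhead y j)
    rw [hxy] at hx
    push_cast at hx
    have hbx := hbd x (Fin.castLE h j)
    have hby := hbd y (Fin.castLE h j)
    have := int_eq_zero_of_abs_mul_lt hs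
      (D := (a (ω x) (Fin.castLE h j) : ℤ) - a (ω y) (Fin.castLE h j) - p) (by
        push_cast
        rw [abs_lt, mul_sub, mul_sub, hp7]
        simp only [x₀, x₁] at *
        constructor <;> linarith)
    omega
  have hlin : ∀ (i : ℕ) (x : Fin m → Fin k) (j : Fin m), (x j : ℕ) = i →
      (a (ω x) (Fin.castLE h j) : ℤ) = a (ω x₀) (Fin.castLE h j) + p * i := by
    intro i
    induction i with
    | zero =>
      intro x j hx
      rw [hsame x x₀ j (Fin.ext hx)]
      simp
    | succ i ih =>
      intro x j hx
      have hi : i < k := by have := (x j).2; omega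
      rw [hstep x (Function.update x j ⟨i, hi⟩) j (by simp [hx]),
        ih (Function.update x j ⟨i, hi⟩) j (by simp)]
      push_cast
      ring
  obtain hp0 | hp0 := hp0.eq_or_lt
  · apply ha
    ext l
    obtain ⟨j, rfl⟩ | ⟨j, rfl⟩ := eq_castLE_or_eq_tailIdx h l
    · have e1 := hlin _ x j rfl
      have e2 := hlin _ x' j rfl
      rw [← hp0] at e1 e2
      omega
    · exact hT x x' j
  · obtain ⟨y, hy⟩ := (patchFree_iff hk hm A).1 hA (fun j => a (ω x₀) (Fin.castLE h j)) p.toNat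
      (by omega)
    refine absurd ?_ hy
    convert haA (ω y) using 1
    ext j
    zify
    rw [hlin _ y j rfl, Int.toNat_of_nonneg hp0.le]

/-- The translations of the maps `x ↦ cellCorner ε a i + (ε / 4) • x`: grid points of spacing
`7 ε`, with `a i` counted from `1`. -/
noncomputable def cellCorner {ι : Type*} {d : ℕ} (ε : ℝ) (a : ι → Fin d → ℕ) (i : ι) : Space d :=
  WithLp.toLp 2 fun l => 7 * ε * (a i l - 1)

theorem not_containsApproxAP_range_codePoint {d m k n : ℕ} [NeZero n] (h : m ≤ d) (hk : 2 ≤ k)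
    (hm : 1 ≤ m) {ε : ℝ} (hε : 0 < ε) (hε8 : ε < 1 / 8) {A : Finset (Fin m → ℕ)}
    (hA : PatchFree k A) {a : Fin n → Fin d → ℕ} (ha : Function.Injective a)
    (haA : ∀ i, (fun j => a i (Fin.castLE h j)) ∈ A)
    (hτ : ∀ i l, 0 ≤ cellCorner ε a i l ∧ cellCorner ε a i l ≤ 1 - ε / 4) :
    ¬ ContainsApproxAP k ε (stdVec h) (Set.range (codePoint (ε / 4) (cellCorner ε a))) := by
  have hc0 : 0 < ε / 4 := by positivity
  have hc1 : ε / 4 < 1 := by linarith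
  intro hAP
  obtain ⟨t, Δ, hΔ, hx⟩ := hAP.exists_of_isCompact
    (isCompact_range (continuous_codePoint hc0 hc1)) (Set.range_nonempty _) hε.le
  have hcoord : ∀ x : Fin m → Fin k, ∃ ω : ℕ → Fin n,
      (∀ j, |codePoint (ε / 4) (cellCorner ε a) ω (Fin.castLE h j) -
        (t (Fin.castLE h j) + Δ * (x j : ℕ))| ≤ ε * Δ) ∧
      ∀ j, |codePoint (ε / 4) (cellCorner ε a) ω (tailIdx h j) - t (tailIdx h j)| ≤ ε * Δ := by
    intro x
    obtain ⟨_, ⟨ω, rfl⟩, hd⟩ := hx x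
    rw [dist_comm, dist_eq_norm] at hd
    refine ⟨ω, fun j => ?_, fun j => ?_⟩
    · have := (PiLp.norm_apply_le _ (Fin.castLE h j)).trans hd
      rwa [PiLp.sub_apply, patchPoint_castLE] at this
    · have := (PiLp.norm_apply_le _ (tailIdx h j)).trans hd
      rwa [PiLp.sub_apply, patchPoint_tailIdx] at this
  choose ω hhead htail using hcoord
  have first : ∀ (t : Fin d → ℝ) (Δ : ℝ) (ω : (Fin m → Fin k) → ℕ → Fin n), 0 < Δ →
      (∀ x j, |codePoint (ε / 4) (cellCorner ε a) (ω x) (Fin.castLE h j) -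
        (t (Fin.castLE h j) + Δ * (x j : ℕ))| ≤ ε * Δ) →
      (∀ x j, |codePoint (ε / 4) (cellCorner ε a) (ω x) (tailIdx h j) - t (tailIdx h j)|
        ≤ ε * Δ) → ∀ x x', ω x 0 = ω x' 0 := by
    intro t Δ ω hΔ hhead htail x x'
    exact digit_eq_of_approx_patch h hk hm hε hε8 hΔ hA ha haA (ω := fun x => ω x 0)
      (w := fun x => codePoint (ε / 4) (cellCorner ε a) (ω x))
      (u := fun x => codePoint (ε / 4) (cellCorner ε a) fun j => ω x (j + 1))
      (fun x => codePoint_mem_unitCube hc0 hc1 hτ _)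
      (fun x => codePoint_mem_unitCube hc0 hc1 hτ _)
      (fun x l => by
        simp only
        rw [codePoint_eq_add_smul hc0 hc1]
        simp [cellCorner])
      t hhead htail x x'
  -- For later positions, remove the common first digit and rescale.
  have key : ∀ (p : ℕ) (t : Fin d → ℝ) (Δ : ℝ) (ω : (Fin m → Fin k) → ℕ → Fin n), 0 < Δ →
      (∀ x j, |codePoint (ε / 4) (cellCorner ε a) (ω x) (Fin.castLE h j) -
        (t (Fin.castLE h j) + Δ * (x j : ℕ))| ≤ ε * Δ) →
      (∀ x j, |codePoint (ε / 4) (cellCorner ε a) (ω x) (tailIdx h j) - t (tailIdx h j)|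
        ≤ ε * Δ) → ∀ x x', ω x p = ω x' p := by
    intro p
    induction p with
    | zero => exact first
    | succ p ih =>
      intro t Δ ω hΔ hhead htail x x'
      let i₀ : Fin n := ω x 0
      have hi₀ : ∀ y, ω y 0 = i₀ := fun y => first t Δ ω hΔ hhead htail y x
      have hz : ∀ y l, codePoint (ε / 4) (cellCorner ε a) (fun j => ω y (j + 1)) l =
          (codePoint (ε / 4) (cellCorner ε a) (ω y) l - cellCorner ε a i₀ l) / (ε / 4) := by
        intro y l
        rw [codePoint_eq_add_smul hc0 hc1 (ω y), hi₀]
        simp only [PiLp.add_apply, PiLp.smul_apply, smul_eq_mul]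
        field_simp
        ring
      refine ih (fun l => (t l - cellCorner ε a i₀ l) / (ε / 4)) (Δ / (ε / 4))
        (fun y j => ω y (j + 1)) (by positivity) (fun y j => ?_) (fun y j => ?_) x x'
      · rw [hz, show ∀ A B T D X : ℝ, (A - B) / (ε / 4) - ((T - B) / (ε / 4) + D / (ε / 4) * X) =
          (A - (T + D * X)) / (ε / 4) by intros; ring, abs_div, abs_of_pos hc0, ← mul_div_assoc]
        gcongr
        exact hhead y j
      · rw [hz, ← sub_div, sub_sub_sub_cancel_right, abs_div, abs_of_pos hc0, ← mul_div_assoc]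
        gcongr
        exact htail y j
  -- So all approximating points coincide, while those for adjacent patch points are at distance at
  -- least `Δ - 2 * ε * Δ > 0`.
  have heq := fun p => key p t Δ ω hΔ hhead htail
  have h0 := abs_le.1 (hhead (fun _ => ⟨0, by omega⟩) ⟨0, hm⟩)
  have h1 := abs_le.1 (hhead (fun _ => ⟨1, by omega⟩) ⟨0, hm⟩)
  rw [show ω (fun _ => ⟨1, by omega⟩) = ω (fun _ => ⟨0, by omega⟩) from
    funext fun p => heq p _ _] at h1
  simp only [Nat.cast_zero, Nat.cast_one, mul_zero, mul_one, add_zero] at h0 h1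
  nlinarith

/-- The hypothesis `8 * ε * (N - 1) ≤ 1` leaves room in the unit interval for `N` cells of side
`ε / 4` at spacing `7 * ε`, a spacing that `digit_eq_of_approx_patch` needs. -/
theorem ofReal_le_DSsim {d m k N : ℕ} (h : m ≤ d) (hk : 2 ≤ k) (hm : 1 ≤ m) {ε : ℝ} (hε : 0 < ε)
    (hε8 : ε < 1 / 8) (hN : 1 ≤ N) (hNε : 8 * ε * (N - 1) ≤ 1) :
    ENNReal.ofReal (Real.log ((N ^ (d - m) * rkm k m N : ℕ) : ℝ) / Real.log (4 / ε)) ≤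
      DSsim k ε h := by
  classical
  obtain ⟨A, hAN, hA, hAcard⟩ := exists_card_eq_rkm hk hm hN
  -- Digits in `{1, …, N} ^ d` whose first `m` coordinates lie in `A`.
  let T : Finset ((Fin m → ℕ) × (Fin (d - m) → ℕ)) :=
    A ×ˢ Fintype.piFinset fun _ => Finset.Icc 1 N
  have hTcard : T.card = N ^ (d - m) * rkm k m N := by
    simp [T, hAcard, mul_comm]
  let join : (Fin m → ℕ) × (Fin (d - m) → ℕ) → Fin d → ℕ := fun z l =>
    if hl : (l : ℕ) < m then z.1 ⟨l, hl⟩ else z.2 ⟨l - m, by have := l.2; omega⟩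
  have hjoin1 : ∀ z j, join z (Fin.castLE h j) = z.1 j := fun z j => by simp [join]
  have hjoin2 : ∀ z j, join z (tailIdx h j) = z.2 j := fun z j => by simp [join, tailIdx]
  set n := N ^ (d - m) * rkm k m N with hn
  have hn1 : 1 ≤ n := Nat.mul_pos (by positivity) (one_le_rkm hk hm hN)
  have : NeZero n := ⟨by omega⟩
  let e : Fin n ≃ T := (finCongr hTcard.symm).trans T.equivFin.symm
  let a : Fin n → Fin d → ℕ := fun i => join (e i)
  have ha : Function.Injective a := by
    intro i j hij
    refine e.injective (Subtype.ext (Prod.ext (funext fun l => ?_) (funext fun l => ?_)))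
    · rw [← hjoin1, ← hjoin1]
      exact congrFun hij _
    · rw [← hjoin2, ← hjoin2]
      exact congrFun hij _
  have haA : ∀ i, (fun j => a i (Fin.castLE h j)) ∈ A := by
    intro i
    simp only [a, hjoin1]
    exact (Finset.mem_product.1 (e i).2).1
  have haN : ∀ i l, 1 ≤ a i l ∧ a i l ≤ N := by
    intro i l
    obtain ⟨h1, h2⟩ := Finset.mem_product.1 (e i).2
    obtain ⟨j, rfl⟩ | ⟨j, rfl⟩ := eq_castLE_or_eq_tailIdx h l
    · have := Finset.mem_Icc.1 (hAN h1)
      simp only [a, hjoin1]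
      exact ⟨this.1 j, this.2 j⟩
    · simp only [a, hjoin2]
      exact Finset.mem_Icc.1 (Fintype.mem_piFinset.1 h2 j)
  have hτ : ∀ i l, 0 ≤ cellCorner ε a i l ∧ cellCorner ε a i l ≤ 1 - ε / 4 := by
    intro i l
    have h1 : (1 : ℝ) ≤ a i l := by exact_mod_cast (haN i l).1
    have h2 : (a i l : ℝ) ≤ N := by exact_mod_cast (haN i l).2
    simp only [cellCorner]
    constructor
    · have : 0 ≤ (a i l : ℝ) - 1 := by linarith
      positivity
    · nlinarith
  have hsep : Pairwise fun i j => ∃ l, ε / 4 + ε ≤ |cellCorner ε a i l - cellCorner ε a j l| := by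
    intro i j hij
    obtain ⟨l, hl⟩ := Function.ne_iff.1 (ha.ne hij)
    refine ⟨l, ?_⟩
    have h1 : (1 : ℝ) ≤ |(a i l : ℝ) - a j l| := by
      have : (1 : ℤ) ≤ |(a i l : ℤ) - a j l| := Int.one_le_abs (by omega)
      exact_mod_cast this
    simp only [cellCorner]
    rw [← mul_sub, sub_sub_sub_cancel_right, abs_mul, abs_of_pos (by positivity)]
    nlinarith
  have hc0 : 0 < ε / 4 := by positivity
  have hc1 : ε / 4 < 1 := by linarith
  have hdim := le_dimH_range_codePoint hε hn1 hc0 hc1 hτ hsep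
  rw [one_div_div] at hdim
  refine hdim.trans (le_iSup₂ (f := fun (F : Set (Space d))
    (_ : IsSelfSimilarOSC F ∧ ¬ ContainsApproxAP k ε (stdVec h) F) => dimH F) _ ⟨?_, ?_⟩)
  · refine isSelfSimilarOSC_range_codePoint hc0 hc1 hτ fun i j hij => ?_
    obtain ⟨l, hl⟩ := hsep hij
    exact ⟨l, by linarith⟩
  · exact not_containsApproxAP_range_codePoint h hk hm hε hε8 hA ha haA hτ

theorem le_DSsim {d m k N : ℕ} (h : m ≤ d) (hk : 2 ≤ k) (hm : 1 ≤ m) {ε : ℝ} (hε : 0 < ε)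
    (hε8 : ε < 1 / 8) (hN : 1 / (8 * ε) ≤ N) (hNε : 8 * ε * (N - 1) ≤ 1) :
    (((d : ℝ) * (1 - Real.log 32 / Real.log (4 / ε))
        + Real.log ((rkm k m N : ℝ) / (N : ℝ) ^ m) / Real.log (4 / ε) : ℝ) : EReal)
      ≤ ((DSsim k ε h : ℝ≥0∞) : EReal) := by
  have hN0 : (0 : ℝ) < N := lt_of_lt_of_le (by positivity) hN
  have hN1 : 1 ≤ N := by exact_mod_cast hN0
  have hr : (0 : ℝ) < rkm k m N := by exact_mod_cast one_le_rkm hk hm hN1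
  have hlog : 0 < Real.log (4 / ε) := Real.log_pos ((one_lt_div hε).2 (by linarith))
  have hle := EReal.coe_ennreal_le_coe_ennreal_iff.2 (ofReal_le_DSsim h hk hm hε hε8 hN1 hNε)
  refine le_trans ?_ hle
  rw [EReal.coe_ennreal_ofReal]
  refine le_trans ?_ (EReal.coe_le_coe_iff.2 (le_max_left _ _))
  rw [EReal.coe_le_coe_iff]
  -- `32 / (4 / ε) = 8 ε`, and `1 / (8 ε) ≤ N`.
  have h8 : Real.log (4 / ε) - Real.log 32 ≤ Real.log N := by
    rw [← Real.log_div (by positivity) (by norm_num)]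
    refine Real.log_le_log (by positivity) (le_trans (le_of_eq ?_) hN)
    field_simp
    norm_num
  rw [one_sub_div hlog.ne', mul_div_assoc', ← add_div]
  gcongr
  push_cast
  rw [Real.log_div hr.ne' (by positivity), Real.log_mul (by positivity) (by positivity),
    Real.log_pow, Real.log_pow, Nat.cast_sub h]
  nlinarith [mul_le_mul_of_nonneg_left h8 d.cast_nonneg (α := ℝ)]

end APDim

theorem corollary2p3 (d m k : ℕ) (hd : 1 ≤ d) (hm : 1 ≤ m) (hmd : m ≤ d) (hk : 2 ≤ k)
    (hk3 : d = 1 → 3 ≤ k) (ε : ℝ) (hε : 0 < ε) (hε8 : ε < 1 / 8) :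
    (((d : ℝ) * (1 - Real.log 32 / Real.log (4 / ε))
        + Real.log ((APDim.rkm k m ⌈1 / (8 * ε)⌉₊ : ℝ) / (⌈1 / (8 * ε)⌉₊ : ℝ) ^ m)
            / Real.log (4 / ε) : ℝ) : EReal)
      ≤ ((APDim.DSsim k ε hmd : ℝ≥0∞) : EReal) ∧
    APDim.DSsim k ε hmd ≤ APDim.DS k ε hmd ∧
    APDim.DS k ε hmd ≤ APDim.DA k ε d m ∧
    ((APDim.DA k ε d m : ℝ≥0∞) : EReal)
      ≤ (((d : ℝ) + 1 / 2 *
          (Real.log ((APDim.rkm k m ⌈√(d : ℝ) / ε⌉₊ : ℝ) / (⌈√(d : ℝ) / ε⌉₊ : ℝ) ^ m)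
            / Real.log (⌈√(d : ℝ) / ε⌉₊ : ℝ)) : ℝ) : EReal) := by
  refine ⟨APDim.le_DSsim hmd hk hm hε hε8 (Nat.le_ceil _) ?_, APDim.DSsim_le_DS hmd ε,
    APDim.DS_le_DA hmd ε, APDim.DA_le hd hmd hk hm ?_ ?_⟩
  · have h1 := Nat.ceil_lt_add_one (show 0 ≤ 1 / (8 * ε) by positivity)
    have h2 : (⌈1 / (8 * ε)⌉₊ : ℝ) - 1 ≤ 1 / (8 * ε) := by linarith
    rwa [le_div_iff₀' (by positivity)] at h2
  · have h1 : (1 : ℝ) < √(d : ℝ) / ε := by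
      rw [one_lt_div hε]
      have : 1 ≤ √(d : ℝ) := Real.one_le_sqrt.2 (by exact_mod_cast hd)
      linarith
    have h2 := h1.trans_le (Nat.le_ceil _)
    exact_mod_cast h2
  · rw [← div_le_iff₀' hε]
    exact Nat.le_ceil _
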